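/- For $k\ge 0$ let $C_k=C_k^{(3/2)}$ be the Gegenbauer polynomial with its standard normalization (orthogonal on $[-1,1]$ for the weight $1-x^2$; $C_0=1$, $C_1=3x$, $kC_k=(2k+1)xC_{k-1}-(k+1)C_{k-2}$ for $k\ge 2$), and put $C_k=0$ for $k<0$. Let $n\ge 1$ and define $$R_n=n^2C_n-(n+1)^2C_{n-2},\qquad S_{n-1}=nC_{n-1}-(n+1)\,x\,C_{n-2},\qquad A=2(n+1)(2n+1)n^2,$$ $$\tilde R_{n-1}=C_{n-1},\qquad \tilde S_{n-2}=(2n-1)C_{n-2}-n\,x\,C_{n-3},\qquad \tilde A=2n(2n-1).$$ 1. $R_n$ has degree $n$ and $n$ distinct real roots $x_1,\dots,x_n$, all in $(-1,1)$, and $R_n'(x_i)S_{n-1}(x_i)\neq 0$ for all $i$. Set $w_i=\dfrac{A}{R_n'(x_i)\,S_{n-1}(x_i)}$. 2. $\tilde R_{n-1}$ has degree $n-1$ and $n-1$ distinct real roots $y_1,\dots,y_{n-1}$, all in $(-1,1)$, and $\tilde R_{n-1}'(y_i)\tilde S_{n-2}(y_i)\ne 0$ for all $i$. Set $v_i=\dfrac{\tilde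 A}{\tilde R_{n-1}'(y_i)\,\tilde S_{n-2}(y_i)}$. 3. Let $a\in\mathbb R$, $h>0$, and let $f:\mathbb R\to\mathbb R$ be a $C^0$ spline of degree at most $2n-1$ on the uniform real line with knots $a+jh$, $j\in\mathbb Z$; that is, $f$ is continuous and on each interval $[a+jh,a+(j+1)h]$ it coincides with a polynomial of degree at most $2n-1$. If $f$ is integrable on $\mathbb R$ (for instance, if it has compact support), then $$\int_{\mathbb R} f(x)\,dx=\sum_{k\in\mathbb Z}\left[\sum_{i=1}^{n}\frac h2\,w_i\,f\!\left(a+2kh+\frac h2(x_i+1)\right)+\sum_{i=1}^{n-1}\frac h2\,v_i\,f\!\left(a+(2k+1)h+\frac h2(y_i+1)\right)\right],$$ where the sum over $k$ converges unconditionally. -/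

import Mathlib

open Polynomial MeasureTheory

noncomputable section

namespace SplineQuadrature

/-- The Gegenbauer (ultraspherical) polynomials `C_k^{(lam)}`, `k ≥ 0`, in their standard
normalization, by the three-term recurrence
`k C_k = 2 (k + lam - 1) x C_{k-1} - (k + 2 lam - 2) C_{k-2}`, `C_0 = 1`, `C_1 = 2 lam x`. -/
def gegenbauerNat (lam : ℝ) : ℕ → ℝ[X]
  | 0 => 1
  | 1 => C (2 * lam) * X
  | k + 2 =>
      C (2 * ((k : ℝ) + 1 + lam) / ((k : ℝ) + 2)) * X * gegenbauerNat lam (k + 1)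
        - C (((k : ℝ) + 2 * lam) / ((k : ℝ) + 2)) * gegenbauerNat lam k

/-- Gegenbauer polynomials with an integer index; they are zero for negative index. -/
def gegenbauer (lam : ℝ) : ℤ → ℝ[X]
  | Int.ofNat k => gegenbauerNat lam k
  | Int.negSucc _ => 0

/-- `C_k = C_k^{(3/2)}`, orthogonal on `[-1, 1]` for the weight function `1 - x ^ 2`. -/
def geg (k : ℤ) : ℝ[X] := gegenbauer (3 / 2) k

/-- First interval: `R_n = n² C_n - (n+1)² C_{n-2}`. -/
def firstR (n : ℕ) : ℝ[X] :=
  C ((n : ℝ) ^ 2) * geg (n : ℤ) - C (((n : ℝ) + 1) ^ 2) * geg ((n : ℤ) - 2)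

/-- First interval: `S_{n-1} = n C_{n-1} - (n+1) x C_{n-2}`. -/
def firstS (n : ℕ) : ℝ[X] :=
  C (n : ℝ) * geg ((n : ℤ) - 1) - C ((n : ℝ) + 1) * X * geg ((n : ℤ) - 2)

/-- First interval: `A = 2 (n+1) (2n+1) n²`. -/
def firstA (n : ℕ) : ℝ := 2 * ((n : ℝ) + 1) * (2 * (n : ℝ) + 1) * (n : ℝ) ^ 2

/-- Second interval: `R_{n-1} = C_{n-1}`. -/
def secondR (n : ℕ) : ℝ[X] := geg ((n : ℤ) - 1)

/-- Second interval: `S_{n-2} = (2n-1) C_{n-2} - n x C_{n-3}`. -/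
def secondS (n : ℕ) : ℝ[X] :=
  C (2 * (n : ℝ) - 1) * geg ((n : ℤ) - 2) - C (n : ℝ) * X * geg ((n : ℤ) - 3)

/-- Second interval: `A = 2 n (2n-1)`. -/
def secondA (n : ℕ) : ℝ := 2 * (n : ℝ) * (2 * (n : ℝ) - 1)

/-- The nodes defined by a polynomial `R`: the set of its (distinct) real roots. -/
def nodes (R : ℝ[X]) : Finset ℝ := R.roots.toFinset

/-- The weight `A / (R'(x) S(x))`. -/
def weight (A : ℝ) (R S : ℝ[X]) (x : ℝ) : ℝ := A / (R.derivative.eval x * S.eval x)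

/-- The rule on the reference interval `[-1, 1]` given by `A`, `R`, `S`, transported affinely to
the interval `[l, l + h]`: the node `x` moves to `l + h (x + 1) / 2` and its weight is multiplied
by half the interval length. -/
def intervalRule (A : ℝ) (R S : ℝ[X]) (l h : ℝ) (f : ℝ → ℝ) : ℝ :=
  ∑ x ∈ nodes R, h / 2 * weight A R S x * f (l + h * (x + 1) / 2)

/-- The contribution of the `k`-th period `[a + 2kh, a + (2k+2)h]` to the two-interval rule on the
real line with the knots `a + j h`, `j ∈ ℤ`. -/
def periodSum (n : ℕ) (a h : ℝ) (f : ℝ → ℝ) (k : ℤ) : ℝ :=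
  intervalRule (firstA n) (firstR n) (firstS n) (a + (2 * (k : ℝ)) * h) h f
    + intervalRule (secondA n) (secondR n) (secondS n) (a + (2 * (k : ℝ) + 1) * h) h f

/-- `f` is a `C^0` spline of degree (at most) `D` on the uniform real line with the knots
`a + j h`, `j ∈ ℤ`: it is continuous and on every interval between consecutive knots it is a
polynomial of degree at most `D`. -/
structure IsC0Spline (D : ℕ) (a h : ℝ) (f : ℝ → ℝ) : Prop where
  continuous : Continuous f
  piecewise : ∀ j : ℤ, ∃ p : ℝ[X], p.natDegree ≤ D ∧
    ∀ x ∈ Set.Icc (a + (j : ℝ) * h) (a + ((j : ℝ) + 1) * h), f x = p.eval x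

end SplineQuadrature

end

/-!
Write `D_m = C_{m-1}^{(3/2)}`, the derivative of the `m`-th Legendre polynomial, and
`M = 2 / (n (n + 1))`. Everything rests on one identity, `integralLM_legendreDeriv_mul`:
`∫_{-1}^1 D_m q = q(1) - (-1)^m q(-1)` whenever `deg q ≤ m`. It follows from the differential
equation `((1 - x²) D_m)'' = -m (m + 1) D_m` by two integrations by parts, which relate the moments
of `x ^ j` and `x ^ (j - 2)`.

The rule on the first interval is the Gauss rule of `p ↦ ∫ p + M (p(1) + p(-1))`, a positive
functional for which `R_n` and `S_{n-1}` are orthogonal polynomials. The rule on the second interval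
consists of the interior nodes of the Gauss-Lobatto rule, so it represents
`p ↦ ∫ p - M (p(1) + p(-1))`. By the identity above, both orthogonality relations and the constants
`A` reduce to the values of the `D_m` at `±1`. Positivity of the functional, respectively of the
weight `1 - x²`, places simple roots in `(-1, 1)` (`card_nodes_of_orthogonal`), and the weights take
the form `A / (R' S)` because the functional is constant on the products `S R / (x - x_i)`
(`weighted_rule`). Both rules are exact up to degree `2 n - 1` (`first_rule`, `second_rule`).

On one period of two grid intervals the endpoint terms of the two rules cancel at the middle knot
and leave `h M / 2` times the difference of the values of the spline at the two ends. These
differences telescope over `ℤ`. Their sum is zero because the values at the knots are summable: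
`(D_{d+1} - D_d) / 2` is, up to sign, a reproducing kernel for evaluation at `-1` on polynomials of
degree at most `d`, so each knot value is bounded by the `L¹` norm of the spline on the adjacent
interval.
-/

noncomputable section

namespace SplineQuadrature

/-! ### Derivatives of Legendre polynomials -/

/-- The shifted family `D_m = C_{m-1}^{(3/2)}`, that is the derivative of the `m`-th Legendre
polynomial. The shift makes `D_0 = C_{-1} = 0` part of the family, so that no index below is
negative. -/
def legendreDeriv (m : ℕ) : ℝ[X] := geg ((m : ℤ) - 1)

@[simp] lemma legendreDeriv_zero : legendreDeriv 0 = 0 := rfl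

@[simp] lemma legendreDeriv_one : legendreDeriv 1 = 1 := rfl

lemma legendreDeriv_succ (m : ℕ) : legendreDeriv (m + 1) = gegenbauerNat (3 / 2) m := by
  have h : (((m + 1 : ℕ) : ℤ) - 1) = Int.ofNat m := by simp
  rw [legendreDeriv, h]
  rfl

lemma geg_eq_legendreDeriv {k : ℤ} {m : ℕ} (h : k = m - 1) : geg k = legendreDeriv m := by
  rw [legendreDeriv, h]

lemma legendreDeriv_recurrence (m : ℕ) :
    C ((m : ℝ) + 1) * legendreDeriv (m + 2) =
      C (2 * (m : ℝ) + 3) * X * legendreDeriv (m + 1) - C ((m : ℝ) + 2) * legendreDeriv m := by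
  rcases m with _ | k
  · rw [legendreDeriv_succ]
    simp only [gegenbauerNat, legendreDeriv_zero]
    norm_num
  · rw [legendreDeriv_succ, legendreDeriv_succ, legendreDeriv_succ, gegenbauerNat]
    have h : ((k : ℝ) + 2) ≠ 0 := by positivity
    rw [mul_sub, ← mul_assoc, ← mul_assoc, ← mul_assoc, ← C_mul, ← C_mul]
    congr 4
    · push_cast
      field_simp
      ring
    · push_cast
      field_simp
      ring

lemma natDegree_legendreDeriv_succ_le (m : ℕ) : (legendreDeriv (m + 1)).natDegree ≤ m := by
  induction m using Nat.strong_induction_on with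
  | _ m ih =>
    rcases m with _ | m
    · simp
    · have h0 : ((m : ℝ) + 1) ≠ 0 := by positivity
      have h1 := ih m (by omega)
      have h2 : (legendreDeriv m).natDegree ≤ m + 1 := by
        rcases m with _ | m
        · simp
        · exact (ih m (by omega)).trans (by omega)
      rw [← natDegree_C_mul h0, legendreDeriv_recurrence]
      refine (natDegree_sub_le_of_le (m := m + 1) (n := m + 1) ?_ ?_).trans (by simp)
      · rw [mul_assoc]
        refine (natDegree_C_mul_le _ _).trans ?_
        refine natDegree_mul_le.trans ?_
        rw [natDegree_X]
        omega
      · exact (natDegree_C_mul_le _ _).trans h2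

lemma natDegree_legendreDeriv_le (m : ℕ) : (legendreDeriv m).natDegree ≤ m := by
  rcases m with _ | m
  · simp
  · exact (natDegree_legendreDeriv_succ_le m).trans (by omega)

lemma coeff_legendreDeriv_recurrence (m : ℕ) :
    ((m : ℝ) + 1) * (legendreDeriv (m + 2)).coeff (m + 1) =
      (2 * (m : ℝ) + 3) * (legendreDeriv (m + 1)).coeff m := by
  have h := congrArg (fun p => coeff p (m + 1)) (legendreDeriv_recurrence m)
  have h2 : (legendreDeriv m).coeff (m + 1) = 0 :=
    coeff_eq_zero_of_natDegree_lt ((natDegree_legendreDeriv_le m).trans_lt (by omega))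
  simpa only [mul_assoc, coeff_sub, coeff_C_mul, coeff_X_mul, h2, mul_zero, sub_zero] using h

lemma coeff_legendreDeriv_pos (m : ℕ) : 0 < (legendreDeriv (m + 1)).coeff m := by
  induction m with
  | zero => simp
  | succ m ih =>
    have h := coeff_legendreDeriv_recurrence m
    have h1 : 0 < (2 * (m : ℝ) + 3) * (legendreDeriv (m + 1)).coeff m := by positivity
    rw [← h] at h1
    exact (mul_pos_iff_of_pos_left (by positivity)).1 h1

lemma eval_legendreDeriv (m : ℕ) :
    (legendreDeriv m).eval 1 = (m : ℝ) * (m + 1) / 2 ∧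
      (legendreDeriv m).eval (-1) = -(-1) ^ m * ((m : ℝ) * (m + 1) / 2) := by
  induction m using Nat.twoStepInduction with
  | zero => simp
  | one => simp
  | more m ih1 ih2 =>
    have h0 : ((m : ℝ) + 1) ≠ 0 := by positivity
    have h1 := congrArg (eval 1) (legendreDeriv_recurrence m)
    have h2 := congrArg (eval (-1)) (legendreDeriv_recurrence m)
    simp only [eval_mul, eval_sub, eval_C, eval_X, ih1.1, ih1.2, ih2.1, ih2.2] at h1 h2
    constructor
    · apply mul_left_cancel₀ h0
      rw [h1]
      push_cast
      ring
    · apply mul_left_cancel₀ h0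
      rw [h2]
      push_cast
      ring

lemma eval_one_legendreDeriv (m : ℕ) : (legendreDeriv m).eval 1 = (m : ℝ) * (m + 1) / 2 :=
  (eval_legendreDeriv m).1

lemma eval_neg_one_legendreDeriv (m : ℕ) :
    (legendreDeriv m).eval (-1) = -(-1) ^ m * ((m : ℝ) * (m + 1) / 2) :=
  (eval_legendreDeriv m).2

/-- The two first-order differential relations between neighbours of the family. They are proved
together because each one needs the other in the induction. -/
lemma derivative_legendreDeriv_relations (m : ℕ) :
    (1 - X ^ 2) * derivative (legendreDeriv (m + 1)) =
        -C (m : ℝ) * X * legendreDeriv (m + 1) + C ((m : ℝ) + 2) * legendreDeriv m ∧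
      (1 - X ^ 2) * derivative (legendreDeriv m) =
        C ((m : ℝ) + 2) * X * legendreDeriv m - C (m : ℝ) * legendreDeriv (m + 1) := by
  induction m with
  | zero => simp
  | succ m ih =>
    obtain ⟨hA, hB⟩ := ih
    have hr := legendreDeriv_recurrence m
    have hd := congrArg derivative hr
    have h0 : (C ((m : ℝ) + 1) : ℝ[X]) ≠ 0 := by
      rw [Ne, C_eq_zero]
      positivity
    simp only [derivative_mul, derivative_sub, derivative_C, derivative_X] at hd
    have hm : ((m + 1 : ℕ) : ℝ) = (m : ℝ) + 1 := by push_cast; rfl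
    rw [hm, show m + 1 + 1 = m + 2 from rfl]
    simp only [map_add, map_mul, map_one, map_ofNat] at *
    constructor
    · apply mul_left_cancel₀ h0
      linear_combination (1 - X ^ 2) * hd + (2 * C (m : ℝ) + 3) * X * hA
        - (C (m : ℝ) + 2) * hB + (C (m : ℝ) + 1) * X * hr
    · linear_combination hA + hr

/-- The differential equation `((1 - x²) D_m)'' = -m (m + 1) D_m`. -/
lemma legendreDeriv_ode (m : ℕ) :
    derivative (derivative ((1 - X ^ 2) * legendreDeriv m)) =
      -C ((m : ℝ) * (m + 1)) * legendreDeriv m := by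
  obtain ⟨hA, hB⟩ := derivative_legendreDeriv_relations m
  have hd := congrArg derivative hB
  have h0 : (1 - X ^ 2 : ℝ[X]) ≠ 0 := by
    intro h
    have := congrArg (eval 0) h
    simp at this
  apply mul_left_cancel₀ h0
  simp only [derivative_mul, derivative_add, derivative_sub, derivative_C, derivative_X,
    derivative_one, derivative_X_sq, derivative_zero] at hd ⊢
  simp only [map_add, map_mul, map_one, map_ofNat] at *
  linear_combination (1 - X ^ 2) * hd + C (m : ℝ) * X * hB - C (m : ℝ) * hA

/-! ### Integrals over the reference interval -/

/-- Integration over `[-1, 1]`, as a linear functional on polynomials. -/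
def integralLM : ℝ[X] →ₗ[ℝ] ℝ where
  toFun p := ∫ x in (-1 : ℝ)..1, p.eval x
  map_add' p q := by
    simp only [eval_add]
    exact intervalIntegral.integral_add (p.continuous.intervalIntegrable _ _)
      (q.continuous.intervalIntegrable _ _)
  map_smul' c p := by
    simp only [eval_smul, RingHom.id_apply]
    exact intervalIntegral.integral_smul c _

lemma integralLM_apply (p : ℝ[X]) : integralLM p = ∫ x in (-1 : ℝ)..1, p.eval x := rfl

lemma integralLM_derivative (p : ℝ[X]) :
    integralLM (derivative p) = p.eval 1 - p.eval (-1) := by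
  rw [integralLM_apply]
  exact intervalIntegral.integral_eq_sub_of_hasDerivAt (fun x _ => p.hasDerivAt x)
    (p.derivative.continuous.intervalIntegrable _ _)

/-- Two integrations by parts: the differential equation makes `D_m` an eigenfunction of a
symmetric second-order operator, up to boundary terms. -/
lemma integralLM_legendreDeriv_mul_second_derivative (m : ℕ) (q : ℝ[X]) :
    (m : ℝ) * (m + 1) * integralLM (legendreDeriv m * q) =
      (m : ℝ) * (m + 1) * (q.eval 1 - (-1) ^ m * q.eval (-1))
        - integralLM ((1 - X ^ 2) * legendreDeriv m * derivative (derivative q)) := by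
  set p := (1 - X ^ 2) * legendreDeriv m with hp
  have hode : derivative (derivative p) = -C ((m : ℝ) * (m + 1)) * legendreDeriv m :=
    legendreDeriv_ode m
  have h := integralLM_derivative (derivative p * q - p * derivative q)
  have h1 : derivative (derivative p * q - p * derivative q) =
      -(((m : ℝ) * (m + 1)) • (legendreDeriv m * q)) - p * derivative (derivative q) := by
    rw [derivative_sub, derivative_mul (f := derivative p), derivative_mul (f := p), hode,
      smul_eq_C_mul]
    ring
  have h2 : (derivative p).eval 1 = -((m : ℝ) * (m + 1)) := by
    simp [hp, eval_one_legendreDeriv]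
    ring
  have h3 : (derivative p).eval (-1) = -((-1) ^ m * ((m : ℝ) * (m + 1))) := by
    simp [hp, eval_neg_one_legendreDeriv]
    ring
  have h4 : p.eval 1 = 0 := by simp [hp]
  have h5 : p.eval (-1) = 0 := by simp [hp]
  clear_value p
  rw [h1, map_sub, map_neg, map_smul, smul_eq_mul, eval_sub, eval_sub, eval_mul, eval_mul,
    eval_mul, eval_mul, h2, h3, h4, h5] at h
  linear_combination -h

/-- The moments of `D_m`, by a recursion in steps of two. -/
lemma integralLM_legendreDeriv_mul_X_pow {m : ℕ} (j : ℕ) (hj : j ≤ m) :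
    integralLM (legendreDeriv m * X ^ j) = 1 - (-1) ^ m * (-1) ^ j := by
  induction j using Nat.strong_induction_on with
  | _ j ih =>
    rcases Nat.eq_zero_or_pos m with rfl | hm
    · obtain rfl : j = 0 := by omega
      simp
    have hm' : (0 : ℝ) < m := by exact_mod_cast hm
    have h := integralLM_legendreDeriv_mul_second_derivative m (X ^ j)
    rcases j with _ | _ | j
    · have h0 : (m : ℝ) * (m + 1) ≠ 0 := by positivity
      apply mul_left_cancel₀ h0
      rw [h]
      simp
    · have h0 : (m : ℝ) * (m + 1) ≠ 0 := by positivity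
      apply mul_left_cancel₀ h0
      rw [h]
      simp
    · have h1 : (1 - X ^ 2) * legendreDeriv m * derivative (derivative (X ^ (j + 2))) =
          (((j : ℝ) + 2) * (j + 1)) • (legendreDeriv m * X ^ j)
            - (((j : ℝ) + 2) * (j + 1)) • (legendreDeriv m * X ^ (j + 2)) := by
        simp only [smul_eq_C_mul, derivative_X_pow, derivative_mul, derivative_C]
        simp
        ring
      rw [h1, map_sub, map_smul, map_smul, ih j (by omega) (by omega)] at h
      simp only [smul_eq_mul, eval_pow, eval_X, one_pow] at h
      have hjm : (j : ℝ) + 2 ≤ m := by exact_mod_cast hj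
      -- The recursion can be solved for the new moment exactly because `j + 2 ≤ m`.
      have h0 : (m : ℝ) * (m + 1) - (j + 2) * (j + 1) ≠ 0 := by
        have : (0 : ℝ) ≤ j := by positivity
        nlinarith
      apply mul_left_cancel₀ h0
      linear_combination h

/-- Against polynomials of degree at most `m`, the density `D_m` on `[-1, 1]` acts as the signed
sum of the two endpoint evaluations. All orthogonality relations, all norms and the control of
spline values at the knots are read off from this identity. -/
lemma integralLM_legendreDeriv_mul {m : ℕ} {q : ℝ[X]} (hq : q.natDegree ≤ m) :
    integralLM (legendreDeriv m * q) = q.eval 1 - (-1) ^ m * q.eval (-1) := by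
  rw [q.as_sum_range' (m + 1) (by omega), Finset.mul_sum, map_sum, eval_finsetSum,
    eval_finsetSum, Finset.mul_sum, ← Finset.sum_sub_distrib]
  refine Finset.sum_congr rfl fun j hj => ?_
  rw [← C_mul_X_pow_eq_monomial, mul_left_comm, ← smul_eq_C_mul, map_smul,
    integralLM_legendreDeriv_mul_X_pow j (by simpa [Nat.lt_succ_iff] using hj)]
  simp
  ring

/-! ### Roots of orthogonal polynomials -/

/-- An orthogonal polynomial `R` for a functional `L` that is positive on `[-1, 1]` has no factor
of positive degree that is non-negative on `[-1, 1]`: from `R = g q` follows `L (R q) = L (g q²) > 0`,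
while `q` has smaller degree than `R`. -/
lemma not_nonneg_factor {L : ℝ[X] →ₗ[ℝ] ℝ} {R g q : ℝ[X]}
    (hpos : ∀ p : ℝ[X], p ≠ 0 → (∀ x ∈ Set.Icc (-1 : ℝ) 1, 0 ≤ p.eval x) → 0 < L p)
    (hR : R ≠ 0) (horth : ∀ q : ℝ[X], q.natDegree < R.natDegree → L (R * q) = 0)
    (hg : g.natDegree ≠ 0) (hRg : R = g * q) : ¬ ∀ x ∈ Set.Icc (-1 : ℝ) 1, 0 ≤ g.eval x := by
  intro h
  have hg0 : g ≠ 0 := by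
    rintro rfl
    simp at hg
  have hq0 : q ≠ 0 := by
    rintro rfl
    simp [hRg] at hR
  have h1 : 0 < L (R * q) := by
    refine hpos _ (mul_ne_zero hR hq0) fun x hx => ?_
    rw [hRg, eval_mul, eval_mul, mul_assoc]
    exact mul_nonneg (h x hx) (mul_self_nonneg _)
  refine h1.ne' (horth q ?_)
  rw [hRg, natDegree_mul hg0 hq0]
  omega

/-- The same for factors that are non-positive on `[-1, 1]`. -/
lemma not_nonpos_factor {L : ℝ[X] →ₗ[ℝ] ℝ} {R g q : ℝ[X]}
    (hpos : ∀ p : ℝ[X], p ≠ 0 → (∀ x ∈ Set.Icc (-1 : ℝ) 1, 0 ≤ p.eval x) → 0 < L p)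
    (hR : R ≠ 0) (horth : ∀ q : ℝ[X], q.natDegree < R.natDegree → L (R * q) = 0)
    (hg : g.natDegree ≠ 0) (hRg : R = g * q) : ¬ ∀ x ∈ Set.Icc (-1 : ℝ) 1, g.eval x ≤ 0 := by
  intro h
  refine not_nonneg_factor (g := -g) (q := -q) hpos hR horth (by simpa using hg)
    (by rw [hRg]; ring) fun x hx => ?_
  simpa using h x hx

lemma eval_nonneg_or_nonpos_of_roots_eq_zero {q : ℝ[X]} (hq : q ≠ 0) (h : q.roots = 0) :
    (∀ x, 0 ≤ q.eval x) ∨ ∀ x, q.eval x ≤ 0 := by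
  by_contra! hcon
  obtain ⟨⟨a, ha⟩, b, hb⟩ := hcon
  obtain ⟨c, hc⟩ := mem_range_of_exists_le_of_exists_ge q.continuous ⟨a, ha.le⟩ ⟨b, hb.le⟩
  have : c ∈ q.roots := (mem_roots hq).2 hc
  simp [h] at this

/-- The roots of an orthogonal polynomial for a functional that is positive on `[-1, 1]` are
real, simple, and lie in `(-1, 1)`. -/
lemma card_nodes_of_orthogonal {L : ℝ[X] →ₗ[ℝ] ℝ} {R : ℝ[X]}
    (hpos : ∀ p : ℝ[X], p ≠ 0 → (∀ x ∈ Set.Icc (-1 : ℝ) 1, 0 ≤ p.eval x) → 0 < L p)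
    (hR : R ≠ 0) (horth : ∀ q : ℝ[X], q.natDegree < R.natDegree → L (R * q) = 0) :
    (nodes R).card = R.natDegree ∧ ∀ x ∈ nodes R, x ∈ Set.Ioo (-1 : ℝ) 1 := by
  have hnodup : R.roots.Nodup := by
    rw [Multiset.nodup_iff_count_le_one]
    intro a
    by_contra! hcount
    rw [count_roots] at hcount
    obtain ⟨q, hq⟩ := (pow_dvd_pow (X - C a) hcount).trans (pow_rootMultiplicity_dvd R a)
    refine not_nonneg_factor hpos hR horth (by simp) hq fun x _ => ?_
    rw [eval_pow]
    exact sq_nonneg _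
  constructor
  · obtain ⟨q, hq, hdeg, hroots⟩ := exists_prod_multiset_X_sub_C_mul R
    have hq0 : q ≠ 0 := by
      rintro rfl
      exact hR (by rw [← hq, mul_zero])
    have hqdeg : q.natDegree = 0 := by
      by_contra hne
      rw [mul_comm] at hq
      rcases eval_nonneg_or_nonpos_of_roots_eq_zero hq0 hroots with h | h
      · exact not_nonneg_factor hpos hR horth hne hq.symm fun x _ => h x
      · exact not_nonpos_factor hpos hR horth hne hq.symm fun x _ => h x
    rw [nodes, Multiset.toFinset_card_of_nodup hnodup]
    omega
  · intro x hx
    rw [nodes, Multiset.mem_toFinset, mem_roots hR] at hx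
    obtain ⟨q, hq⟩ := dvd_iff_isRoot.2 hx
    constructor
    · by_contra! hlt
      refine not_nonneg_factor hpos hR horth (by simp) hq fun y hy => ?_
      simp only [eval_sub, eval_X, eval_C]
      linarith [hy.1]
    · by_contra! hlt
      refine not_nonpos_factor hpos hR horth (by simp) hq fun y hy => ?_
      simp only [eval_sub, eval_X, eval_C]
      linarith [hy.2]

/-! ### Interpolatory quadrature rules -/

lemma eval_divByMonic_self {R : ℝ[X]} {x : ℝ} (hx : R.IsRoot x) :
    (R /ₘ (X - C x)).eval x = R.derivative.eval x := by
  have h := congrArg (fun p => eval x (derivative p)) (mul_divByMonic_eq_iff_isRoot.2 hx)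
  simpa [derivative_mul] using h

lemma eval_divByMonic_of_ne {R : ℝ[X]} {x y : ℝ} (hx : R.IsRoot x) (hy : R.IsRoot y)
    (hne : y ≠ x) : (R /ₘ (X - C x)).eval y = 0 := by
  have h := congrArg (eval y) (mul_divByMonic_eq_iff_isRoot.2 hx)
  rw [eval_mul, eval_sub, eval_X, eval_C, hy] at h
  exact (mul_eq_zero.1 h).resolve_left (sub_ne_zero.2 hne)

/-- A functional that annihilates `R q` for all `q` of degree at most `d` is, up to degree
`deg R + d`, the interpolatory quadrature rule at the simple roots of `R`. -/
lemma interpolatory_rule {L : ℝ[X] →ₗ[ℝ] ℝ} {R p : ℝ[X]} {d : ℕ} (hR : R ≠ 0)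
    (hcard : (nodes R).card = R.natDegree)
    (horth : ∀ q : ℝ[X], q.natDegree ≤ d → L (R * q) = 0) (hp : p.natDegree ≤ R.natDegree + d) :
    (∀ x ∈ nodes R, R.derivative.eval x ≠ 0) ∧
      L p = ∑ x ∈ nodes R, p.eval x / R.derivative.eval x * L (R /ₘ (X - C x)) := by
  have hle : (nodes R).card ≤ Multiset.card R.roots := Multiset.toFinset_card_le _
  have hroots : Multiset.card R.roots = R.natDegree :=
    le_antisymm (card_roots' R) (hcard ▸ hle)
  have hnodup : R.roots.Nodup := by
    rw [← Multiset.toFinset_card_eq_card_iff_nodup, hroots]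
    exact hcard
  have hmem : ∀ x ∈ nodes R, R.IsRoot x := fun x hx => by
    rwa [nodes, Multiset.mem_toFinset, mem_roots hR] at hx
  have hder : ∀ x ∈ nodes R, R.derivative.eval x ≠ 0 := by
    intro x hx h0
    have h1 : 1 < R.rootMultiplicity x :=
      (one_lt_rootMultiplicity_iff_isRoot hR).2 ⟨hmem x hx, h0⟩
    have h2 := Multiset.nodup_iff_count_le_one.1 hnodup x
    rw [count_roots] at h2
    omega
  refine ⟨hder, ?_⟩
  -- `I` is the Lagrange interpolant of `p` at the roots of `R`.
  set I := ∑ x ∈ nodes R, (p.eval x / R.derivative.eval x) • (R /ₘ (X - C x)) with hI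
  have hIdeg : I.natDegree ≤ R.natDegree + d := by
    refine natDegree_sum_le_of_forall_le _ _ fun x _ => (natDegree_smul_le _ _).trans ?_
    rw [natDegree_divByMonic _ (monic_X_sub_C x)]
    omega
  have hIeval : ∀ y ∈ nodes R, I.eval y = p.eval y := by
    intro y hy
    rw [hI, eval_finsetSum, Finset.sum_eq_single_of_mem y hy]
    · rw [eval_smul, eval_divByMonic_self (hmem y hy), smul_eq_mul, div_mul_cancel₀ _ (hder y hy)]
    · intro x hx hne
      rw [eval_smul, eval_divByMonic_of_ne (hmem x hx) (hmem y hy) hne.symm, smul_zero]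
  have hdvd : R ∣ p - I := by
    rcases eq_or_ne (p - I) 0 with h0 | h0
    · rw [h0]
      exact dvd_zero _
    rw [← C_leadingCoeff_mul_prod_multiset_X_sub_C hroots]
    have hu : IsUnit (C R.leadingCoeff : ℝ[X]) := by
      rw [isUnit_C, isUnit_iff_ne_zero]
      exact leadingCoeff_ne_zero.2 hR
    rw [hu.mul_left_dvd, Multiset.prod_X_sub_C_dvd_iff_le_roots h0,
      Multiset.le_iff_subset hnodup]
    intro y hy
    rw [mem_roots h0, IsRoot, eval_sub, hIeval y (by simpa [nodes] using hy), sub_self]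
  obtain ⟨q, hq⟩ := hdvd
  have hqdeg : q.natDegree ≤ d := by
    rcases eq_or_ne q 0 with rfl | hq0
    · simp
    have h1 := natDegree_mul hR hq0
    rw [← hq] at h1
    have h2 := natDegree_sub_le_of_le hp hIdeg
    rw [max_self] at h2
    omega
  have hL := horth q hqdeg
  rw [← hq, map_sub, sub_eq_zero] at hL
  rw [hL, hI, map_sum]
  simp only [map_smul, smul_eq_mul]

/-- The weights of an interpolatory rule in the form `A / (R' S)`: it suffices that the
functional takes the same value `A` on all the products `R / (x - x_i) * S`. -/
lemma weighted_rule {L : ℝ[X] →ₗ[ℝ] ℝ} {R S : ℝ[X]} {A : ℝ} {d : ℕ} (hR : R ≠ 0)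
    (hcard : (nodes R).card = R.natDegree) (hA : A ≠ 0)
    (horth : ∀ q : ℝ[X], q.natDegree ≤ d → L (R * q) = 0) (hd : R.natDegree ≤ d + 1)
    (hSdeg : S.natDegree ≤ R.natDegree - 1)
    (hS : ∀ x ∈ nodes R, L (S * (R /ₘ (X - C x))) = A) :
    (∀ x ∈ nodes R, R.derivative.eval x * S.eval x ≠ 0) ∧
      ∀ p : ℝ[X], p.natDegree ≤ R.natDegree + d →
        L p = ∑ x ∈ nodes R, weight A R S x * p.eval x := by
  have hmem : ∀ x ∈ nodes R, R.IsRoot x := fun x hx => by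
    rwa [nodes, Multiset.mem_toFinset, mem_roots hR] at hx
  have key : ∀ x ∈ nodes R, S.eval x * L (R /ₘ (X - C x)) = A := by
    intro x hx
    have hdeg : (S * (R /ₘ (X - C x))).natDegree ≤ R.natDegree + d := by
      refine natDegree_mul_le.trans ?_
      rw [natDegree_divByMonic _ (monic_X_sub_C x), natDegree_X_sub_C]
      omega
    obtain ⟨hder, hL⟩ := interpolatory_rule hR hcard horth hdeg
    rw [hS x hx, Finset.sum_eq_single_of_mem x hx] at hL
    · rw [hL, eval_mul, eval_divByMonic_self (hmem x hx), mul_div_cancel_right₀ _ (hder x hx)]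
    · intro y hy hne
      rw [eval_mul, eval_divByMonic_of_ne (hmem x hx) (hmem y hy) hne]
      simp
  have hder : ∀ x ∈ nodes R, R.derivative.eval x ≠ 0 :=
    (interpolatory_rule (p := 0) hR hcard horth (by simp)).1
  have hS0 : ∀ x ∈ nodes R, S.eval x ≠ 0 := fun x hx h0 => hA (by rw [← key x hx, h0, zero_mul])
  refine ⟨fun x hx => mul_ne_zero (hder x hx) (hS0 x hx), fun p hp => ?_⟩
  rw [(interpolatory_rule hR hcard horth hp).2]
  refine Finset.sum_congr rfl fun x hx => ?_
  have h1 := hder x hx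
  have h2 := hS0 x hx
  rw [weight, ← key x hx]
  field_simp

/-- If `L` annihilates `S q` for all `q` of degree less than `N`, then on polynomials `q` of
degree at most `N` the value `L (S q)` depends on the coefficient of `x ^ N` only. -/
lemma coeff_mul_eq_of_orthogonal {L : ℝ[X] →ₗ[ℝ] ℝ} {S T q : ℝ[X]} {N : ℕ}
    (horth : ∀ q : ℝ[X], q.degree < N → L (S * q) = 0) (hT : T.natDegree ≤ N)
    (hq : q.natDegree ≤ N) : T.coeff N * L (S * q) = q.coeff N * L (S * T) := by
  have hdeg : (T.coeff N • q - q.coeff N • T).degree < N := by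
    rw [degree_lt_iff_coeff_zero]
    intro k hk
    rcases hk.eq_or_lt with rfl | hk
    · simp [mul_comm]
    · simp [coeff_eq_zero_of_natDegree_lt (hq.trans_lt hk),
        coeff_eq_zero_of_natDegree_lt (hT.trans_lt hk)]
  have h := horth _ hdeg
  rw [mul_sub, mul_smul_comm, mul_smul_comm, map_sub, map_smul, map_smul, sub_eq_zero] at h
  exact h

lemma coeff_divByMonic_X_sub_C {R : ℝ[X]} {x : ℝ} {N : ℕ} (hR : R.natDegree ≤ N + 1)
    (hx : R.IsRoot x) : (R /ₘ (X - C x)).coeff N = R.coeff (N + 1) := by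
  have h := congrArg (fun p => coeff p (N + 1)) (mul_divByMonic_eq_iff_isRoot.2 hx)
  have h0 : (R /ₘ (X - C x)).coeff (N + 1) = 0 := by
    apply coeff_eq_zero_of_natDegree_lt
    rw [natDegree_divByMonic _ (monic_X_sub_C x), natDegree_X_sub_C]
    omega
  simpa [sub_mul, h0] using h

/-! ### Integration corrected by endpoint values -/

/-- The functional `p ↦ ∫_{-1}^1 p + c (p(1) + p(-1))`. -/
def endpointLM (c : ℝ) : ℝ[X] →ₗ[ℝ] ℝ := integralLM + c • (leval 1 + leval (-1))

lemma endpointLM_apply (c : ℝ) (p : ℝ[X]) :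
    endpointLM c p = integralLM p + c * (p.eval 1 + p.eval (-1)) := rfl

lemma integralLM_pos {p : ℝ[X]} (hp : p ≠ 0) (h : ∀ x ∈ Set.Icc (-1 : ℝ) 1, 0 ≤ p.eval x) :
    0 < integralLM p := by
  have hinf : ¬ (Set.Icc (-1 : ℝ) 1 ⊆ {x | p.IsRoot x}) := fun hsub =>
    (Set.Icc_infinite (by norm_num : (-1 : ℝ) < 1)) ((finite_setOfPred_isRoot hp).subset hsub)
  obtain ⟨c, hc, hc0⟩ := Set.not_subset.1 hinf
  exact intervalIntegral.integral_pos (by norm_num) p.continuous.continuousOn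
    (fun x hx => h x (Set.Ioc_subset_Icc_self hx)) ⟨c, hc, lt_of_le_of_ne (h c hc) (Ne.symm hc0)⟩

lemma endpointLM_pos {c : ℝ} (hc : 0 ≤ c) {p : ℝ[X]} (hp : p ≠ 0)
    (h : ∀ x ∈ Set.Icc (-1 : ℝ) 1, 0 ≤ p.eval x) : 0 < endpointLM c p := by
  rw [endpointLM_apply]
  have h1 := h 1 (by norm_num)
  have h2 := h (-1) (by norm_num)
  have h3 := integralLM_pos hp h
  positivity

/-- The weight that the rule on the second interval would put on each endpoint, and the opposite
of the weight on the first interval: `2 / (n (n + 1))`. -/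
def endpointWeight (n : ℕ) : ℝ := 2 / ((n : ℝ) * (n + 1))

lemma endpointWeight_pos {n : ℕ} (hn : n ≠ 0) : 0 < endpointWeight n := by
  have : (0 : ℝ) < n := by positivity
  unfold endpointWeight
  positivity

lemma endpointWeight_mul {n : ℕ} (hn : n ≠ 0) : endpointWeight n * ((n : ℝ) * (n + 1)) = 2 := by
  have : (0 : ℝ) < n := by positivity
  unfold endpointWeight
  field_simp

/-! ### The rule on the first interval -/

lemma firstR_succ (N : ℕ) : firstR (N + 1) =
    C (((N : ℝ) + 1) ^ 2) * legendreDeriv (N + 2) - C (((N : ℝ) + 2) ^ 2) * legendreDeriv N := by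
  rw [firstR, geg_eq_legendreDeriv (m := N + 2) (by push_cast; ring),
    geg_eq_legendreDeriv (k := ((N + 1 : ℕ) : ℤ) - 2) (m := N) (by push_cast; ring)]
  push_cast
  ring_nf

lemma firstS_succ (N : ℕ) : firstS (N + 1) =
    C ((N : ℝ) + 1) * legendreDeriv (N + 1) - C ((N : ℝ) + 2) * X * legendreDeriv N := by
  rw [firstS, geg_eq_legendreDeriv (k := ((N + 1 : ℕ) : ℤ) - 1) (m := N + 1) rfl,
    geg_eq_legendreDeriv (k := ((N + 1 : ℕ) : ℤ) - 2) (m := N) (by push_cast; ring)]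
  push_cast
  ring_nf

lemma natDegree_firstR_le (N : ℕ) : (firstR (N + 1)).natDegree ≤ N + 1 := by
  rw [firstR_succ]
  refine (natDegree_sub_le_of_le (m := N + 1) (n := N + 1) ?_ ?_).trans (by simp)
  · exact (natDegree_C_mul_le _ _).trans (natDegree_legendreDeriv_succ_le _)
  · exact (natDegree_C_mul_le _ _).trans ((natDegree_legendreDeriv_le N).trans (by omega))

lemma coeff_firstR (N : ℕ) : (firstR (N + 1)).coeff (N + 1) =
    ((N : ℝ) + 1) * (2 * N + 3) * (legendreDeriv (N + 1)).coeff N := by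
  have h : (legendreDeriv N).coeff (N + 1) = 0 :=
    coeff_eq_zero_of_natDegree_lt ((natDegree_legendreDeriv_le N).trans_lt (by omega))
  have h2 := coeff_legendreDeriv_recurrence N
  rw [firstR_succ, coeff_sub, coeff_C_mul, coeff_C_mul, h]
  linear_combination ((N : ℝ) + 1) * h2

lemma natDegree_firstR (N : ℕ) : (firstR (N + 1)).natDegree = N + 1 := by
  refine le_antisymm (natDegree_firstR_le N) (le_natDegree_of_ne_zero ?_)
  rw [coeff_firstR]
  have := coeff_legendreDeriv_pos N
  positivity

lemma firstR_ne_zero (N : ℕ) : firstR (N + 1) ≠ 0 := by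
  intro h
  have := natDegree_firstR N
  simp [h] at this

lemma natDegree_firstS_le (N : ℕ) : (firstS (N + 1)).natDegree ≤ N := by
  rw [firstS_succ]
  refine (natDegree_sub_le_of_le (m := N) (n := N) ?_ ?_).trans (by simp)
  · exact (natDegree_C_mul_le _ _).trans (natDegree_legendreDeriv_succ_le _)
  · rcases N with _ | N
    · simp
    · rw [mul_assoc]
      refine (natDegree_C_mul_le _ _).trans (natDegree_mul_le.trans ?_)
      rw [natDegree_X]
      have := natDegree_legendreDeriv_succ_le N
      omega

lemma endpointLM_firstR_mul (N : ℕ) {q : ℝ[X]} (hq : q.natDegree ≤ N) :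
    endpointLM (endpointWeight (N + 1)) (firstR (N + 1) * q) = 0 := by
  have hw := endpointWeight_mul (Nat.succ_ne_zero N)
  have h1 := integralLM_legendreDeriv_mul (m := N + 2) (q := q) (by omega)
  have h2 := integralLM_legendreDeriv_mul (m := N) (q := q) hq
  have h3 : firstR (N + 1) * q = (((N : ℝ) + 1) ^ 2) • (legendreDeriv (N + 2) * q)
      - (((N : ℝ) + 2) ^ 2) • (legendreDeriv N * q) := by
    rw [firstR_succ, smul_eq_C_mul, smul_eq_C_mul]
    ring
  rw [h3, endpointLM_apply, map_sub, map_smul, map_smul, h1, h2]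
  simp only [eval_sub, eval_smul, eval_mul, smul_eq_mul, eval_one_legendreDeriv,
    eval_neg_one_legendreDeriv]
  push_cast at hw ⊢
  linear_combination (q.eval 1 - (-1) ^ N * q.eval (-1)) * (2 * N + 3) / 2 * hw

lemma endpointLM_firstS_mul (N : ℕ) {q : ℝ[X]} (hq : q.degree < N) :
    endpointLM (endpointWeight (N + 1)) (firstS (N + 1) * q) = 0 := by
  rcases eq_or_ne q 0 with rfl | hq0
  · simp
  rw [← natDegree_lt_iff_degree_lt hq0] at hq
  have hw := endpointWeight_mul (Nat.succ_ne_zero N)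
  have h1 := integralLM_legendreDeriv_mul (m := N + 1) (q := q) (by omega)
  have h2 := integralLM_legendreDeriv_mul (m := N) (q := X * q)
    (by rw [natDegree_X_mul hq0]; omega)
  have h3 : firstS (N + 1) * q = ((N : ℝ) + 1) • (legendreDeriv (N + 1) * q)
      - ((N : ℝ) + 2) • (legendreDeriv N * (X * q)) := by
    rw [firstS_succ, smul_eq_C_mul, smul_eq_C_mul]
    ring
  rw [h3, endpointLM_apply, map_sub, map_smul, map_smul, h1, h2]
  simp only [eval_sub, eval_smul, eval_mul, smul_eq_mul, eval_one_legendreDeriv,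
    eval_neg_one_legendreDeriv, eval_X]
  push_cast at hw ⊢
  linear_combination (q.eval 1 + (-1) ^ N * q.eval (-1)) / 2 * hw

lemma endpointLM_firstS_mul_legendreDeriv (N : ℕ) :
    endpointLM (endpointWeight (N + 1)) (firstS (N + 1) * legendreDeriv (N + 1)) =
      2 * ((N : ℝ) + 1) * (N + 2) := by
  have hw := endpointWeight_mul (Nat.succ_ne_zero N)
  have h1 := integralLM_legendreDeriv_mul (m := N + 1) (q := firstS (N + 1))
    ((natDegree_firstS_le N).trans (by omega))
  have hsq : ((-1 : ℝ) ^ N) ^ 2 = 1 := by rw [← pow_mul, mul_comm, pow_mul]; norm_num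
  rw [endpointLM_apply, mul_comm (firstS _), h1, firstS_succ]
  simp only [eval_sub, eval_mul, eval_C, eval_one_legendreDeriv,
    eval_neg_one_legendreDeriv, eval_X, pow_succ (-1 : ℝ) N]
  push_cast at hw ⊢
  generalize (-1 : ℝ) ^ N = e at *
  generalize endpointWeight (N + 1) = w at *
  linear_combination ((N + 1) * (N + 2) / 2 + w * ((N + 1) * (N + 2) / 2) ^ 2) * hsq
    + (N + 1) * (N + 2) / 2 * hw

/-- The polynomials `S` are orthogonal for the same functional as `R`, so that the value
on `S R / (x - x_i)` is a ratio of leading coefficients times one explicit norm. -/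
lemma endpointLM_firstS_mul_divByMonic (N : ℕ) {x : ℝ} (hx : (firstR (N + 1)).IsRoot x) :
    endpointLM (endpointWeight (N + 1)) (firstS (N + 1) * (firstR (N + 1) /ₘ (X - C x))) =
      firstA (N + 1) := by
  have h := coeff_mul_eq_of_orthogonal (L := endpointLM (endpointWeight (N + 1)))
    (S := firstS (N + 1)) (T := legendreDeriv (N + 1)) (q := firstR (N + 1) /ₘ (X - C x)) (N := N)
    (fun q hq => endpointLM_firstS_mul N hq) (natDegree_legendreDeriv_succ_le N)
    (by rw [natDegree_divByMonic _ (monic_X_sub_C x), natDegree_X_sub_C, natDegree_firstR]; omega)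
  rw [coeff_divByMonic_X_sub_C (natDegree_firstR_le N) hx, coeff_firstR,
    endpointLM_firstS_mul_legendreDeriv] at h
  apply mul_left_cancel₀ (coeff_legendreDeriv_pos N).ne'
  rw [h, firstA]
  push_cast
  ring

/-- The first rule is the Gauss rule of the positive functional
`p ↦ ∫_{-1}^1 p + 2 / (n (n + 1)) (p(1) + p(-1))`. -/
lemma first_rule (N : ℕ) :
    (nodes (firstR (N + 1))).card = N + 1 ∧
    (∀ x ∈ nodes (firstR (N + 1)), x ∈ Set.Ioo (-1 : ℝ) 1 ∧
      (firstR (N + 1)).derivative.eval x * (firstS (N + 1)).eval x ≠ 0) ∧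
    ∀ p : ℝ[X], p.natDegree ≤ 2 * N + 1 → endpointLM (endpointWeight (N + 1)) p =
      ∑ x ∈ nodes (firstR (N + 1)),
        weight (firstA (N + 1)) (firstR (N + 1)) (firstS (N + 1)) x * p.eval x := by
  have hdeg := natDegree_firstR N
  obtain ⟨hcard, hIoo⟩ := card_nodes_of_orthogonal
    (L := endpointLM (endpointWeight (N + 1))) (R := firstR (N + 1))
    (fun p hp h => endpointLM_pos (endpointWeight_pos (Nat.succ_ne_zero N)).le hp h)
    (firstR_ne_zero N) (fun q hq => endpointLM_firstR_mul N (by omega))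
  have hA : firstA (N + 1) ≠ 0 := by
    unfold firstA
    positivity
  obtain ⟨hne, hrule⟩ := weighted_rule (d := N) (firstR_ne_zero N) hcard hA
    (fun q hq => endpointLM_firstR_mul N hq) (by omega)
    (by rw [hdeg]; exact natDegree_firstS_le N)
    (fun x hx => endpointLM_firstS_mul_divByMonic N (by
      rwa [nodes, Multiset.mem_toFinset, mem_roots (firstR_ne_zero N)] at hx))
  exact ⟨hcard.trans hdeg, fun x hx => ⟨hIoo x hx, hne x hx⟩,
    fun p hp => hrule p (by omega)⟩

/-! ### The rule on the second interval -/

lemma secondR_succ (N : ℕ) : secondR (N + 1) = legendreDeriv (N + 1) := by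
  rw [secondR, legendreDeriv]

lemma secondS_succ_succ (N : ℕ) : secondS (N + 2) =
    C (2 * (N : ℝ) + 3) * legendreDeriv (N + 1) - C ((N : ℝ) + 2) * X * legendreDeriv N := by
  rw [secondS, geg_eq_legendreDeriv (k := ((N + 2 : ℕ) : ℤ) - 2) (m := N + 1) (by push_cast; ring),
    geg_eq_legendreDeriv (k := ((N + 2 : ℕ) : ℤ) - 3) (m := N) (by push_cast; ring)]
  push_cast
  ring_nf

lemma natDegree_secondR (N : ℕ) : (secondR (N + 1)).natDegree = N := by
  rw [secondR_succ]
  exact le_antisymm (natDegree_legendreDeriv_succ_le N)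
    (le_natDegree_of_ne_zero (coeff_legendreDeriv_pos N).ne')

lemma secondR_ne_zero (N : ℕ) : secondR (N + 1) ≠ 0 := by
  intro h
  have := coeff_legendreDeriv_pos N
  rw [← secondR_succ, h, coeff_zero] at this
  exact this.false

lemma natDegree_secondS_le (N : ℕ) : (secondS (N + 2)).natDegree ≤ N := by
  rw [secondS_succ_succ]
  refine (natDegree_sub_le_of_le (m := N) (n := N) ?_ ?_).trans (by simp)
  · exact (natDegree_C_mul_le _ _).trans (natDegree_legendreDeriv_succ_le _)
  · rcases N with _ | N
    · simp
    · rw [mul_assoc]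
      refine (natDegree_C_mul_le _ _).trans (natDegree_mul_le.trans ?_)
      rw [natDegree_X]
      have := natDegree_legendreDeriv_succ_le N
      omega

lemma endpointLM_secondR_mul (N : ℕ) {q : ℝ[X]} (hq : q.natDegree ≤ N + 1) :
    endpointLM (-endpointWeight (N + 1)) (secondR (N + 1) * q) = 0 := by
  have hw := endpointWeight_mul (Nat.succ_ne_zero N)
  rw [secondR_succ, endpointLM_apply, integralLM_legendreDeriv_mul hq]
  simp only [eval_mul, eval_one_legendreDeriv, eval_neg_one_legendreDeriv]
  push_cast at hw ⊢
  linear_combination (-q.eval 1 - (-1) ^ N * q.eval (-1)) / 2 * hw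

lemma endpointLM_secondS_mul (N : ℕ) {q : ℝ[X]} (hq : q.degree < N) :
    endpointLM (-endpointWeight (N + 2)) (secondS (N + 2) * q) = 0 := by
  rcases eq_or_ne q 0 with rfl | hq0
  · simp
  rw [← natDegree_lt_iff_degree_lt hq0] at hq
  have hw := endpointWeight_mul (Nat.succ_ne_zero (N + 1))
  have h1 := integralLM_legendreDeriv_mul (m := N + 1) (q := q) (by omega)
  have h2 := integralLM_legendreDeriv_mul (m := N) (q := X * q)
    (by rw [natDegree_X_mul hq0]; omega)
  have h3 : secondS (N + 2) * q = (2 * (N : ℝ) + 3) • (legendreDeriv (N + 1) * q)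
      - ((N : ℝ) + 2) • (legendreDeriv N * (X * q)) := by
    rw [secondS_succ_succ, smul_eq_C_mul, smul_eq_C_mul]
    ring
  rw [h3, endpointLM_apply, map_sub, map_smul, map_smul, h1, h2]
  simp only [eval_sub, eval_smul, eval_mul, smul_eq_mul, eval_one_legendreDeriv,
    eval_neg_one_legendreDeriv, eval_X]
  push_cast at hw ⊢
  linear_combination (-q.eval 1 - (-1) ^ N * q.eval (-1)) * (N + 1) / 2 * hw

lemma endpointLM_secondS_mul_legendreDeriv (N : ℕ) :
    endpointLM (-endpointWeight (N + 2)) (secondS (N + 2) * legendreDeriv (N + 1)) =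
      2 * ((N : ℝ) + 1) * (N + 2) := by
  have hw := endpointWeight_mul (Nat.succ_ne_zero (N + 1))
  have h1 := integralLM_legendreDeriv_mul (m := N + 1) (q := secondS (N + 2))
    ((natDegree_secondS_le N).trans (by omega))
  have hsq : ((-1 : ℝ) ^ N) ^ 2 = 1 := by rw [← pow_mul, mul_comm, pow_mul]; norm_num
  rw [endpointLM_apply, mul_comm (secondS _), h1, secondS_succ_succ]
  simp only [eval_sub, eval_mul, eval_C, eval_one_legendreDeriv,
    eval_neg_one_legendreDeriv, eval_X, pow_succ (-1 : ℝ) N]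
  push_cast at hw ⊢
  generalize (-1 : ℝ) ^ N = e at *
  generalize endpointWeight (N + 2) = w at *
  linear_combination ((N + 1) * (N + 2) * (N + 3) / 2
    - w * ((N + 1) * (N + 2) * (N + 3) / 2) * ((N + 1) * (N + 2) / 2)) * hsq
    - (N + 1) * (N + 2) / 2 * (N + 1) * hw

lemma endpointLM_secondS_mul_divByMonic (N : ℕ) {x : ℝ} (hx : (secondR (N + 2)).IsRoot x) :
    endpointLM (-endpointWeight (N + 2)) (secondS (N + 2) * (secondR (N + 2) /ₘ (X - C x))) =
      secondA (N + 2) := by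
  have hdeg := natDegree_secondR (N + 1)
  have h := coeff_mul_eq_of_orthogonal (L := endpointLM (-endpointWeight (N + 2)))
    (S := secondS (N + 2)) (T := legendreDeriv (N + 1)) (q := secondR (N + 2) /ₘ (X - C x))
    (N := N) (fun q hq => endpointLM_secondS_mul N hq) (natDegree_legendreDeriv_succ_le N)
    (by rw [natDegree_divByMonic _ (monic_X_sub_C x), natDegree_X_sub_C, hdeg]; omega)
  have hlead : (secondR (N + 2)).coeff (N + 1) = (legendreDeriv (N + 2)).coeff (N + 1) :=
    congrArg (fun p => coeff p (N + 1)) (secondR_succ (N + 1))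
  rw [coeff_divByMonic_X_sub_C hdeg.le hx, hlead,
    endpointLM_secondS_mul_legendreDeriv] at h
  apply mul_left_cancel₀ (coeff_legendreDeriv_pos N).ne'
  rw [h, secondA]
  push_cast
  linear_combination 2 * ((N : ℝ) + 2) * coeff_legendreDeriv_recurrence N

/-- The roots of `D_{N+1}` are governed by the positive functional `p ↦ ∫_{-1}^1 (1 - x²) p`. -/
lemma card_nodes_secondR (N : ℕ) :
    (nodes (secondR (N + 1))).card = N ∧
      ∀ x ∈ nodes (secondR (N + 1)), x ∈ Set.Ioo (-1 : ℝ) 1 := by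
  have hdeg := natDegree_secondR N
  have h0 : (1 - X ^ 2 : ℝ[X]) ≠ 0 := by
    intro h
    have := congrArg (eval 0) h
    simp at this
  have h2 : (1 - X ^ 2 : ℝ[X]).natDegree ≤ 2 := by compute_degree
  have h := card_nodes_of_orthogonal (L := integralLM ∘ₗ LinearMap.mulLeft ℝ (1 - X ^ 2))
    (R := secondR (N + 1)) (fun p hp h => ?_) (secondR_ne_zero N) (fun q hq => ?_)
  · exact ⟨h.1.trans hdeg, h.2⟩
  · refine integralLM_pos (mul_ne_zero h0 hp) fun x hx => ?_
    rw [LinearMap.mulLeft_apply, eval_mul]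
    refine mul_nonneg ?_ (h x hx)
    simp only [eval_sub, eval_one, eval_pow, eval_X]
    nlinarith [hx.1, hx.2]
  · rw [LinearMap.comp_apply, LinearMap.mulLeft_apply, secondR_succ, mul_left_comm,
      integralLM_legendreDeriv_mul]
    · simp
    · refine natDegree_mul_le.trans ?_
      omega

/-- The second rule is the Gauss-Lobatto rule with its two endpoint terms moved to the functional
`p ↦ ∫_{-1}^1 p - 2 / (n (n + 1)) (p(1) + p(-1))`. -/
lemma second_rule (N : ℕ) :
    (∀ x ∈ nodes (secondR (N + 1)),
      (secondR (N + 1)).derivative.eval x * (secondS (N + 1)).eval x ≠ 0) ∧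
    ∀ p : ℝ[X], p.natDegree ≤ 2 * N + 1 → endpointLM (-endpointWeight (N + 1)) p =
      ∑ x ∈ nodes (secondR (N + 1)),
        weight (secondA (N + 1)) (secondR (N + 1)) (secondS (N + 1)) x * p.eval x := by
  have hdeg := natDegree_secondR N
  have hcard := (card_nodes_secondR N).1
  -- For `N = 0` there are no nodes and `secondR = 1`; the claim is the trapezoidal rule.
  have hdiv : ∀ x ∈ nodes (secondR (N + 1)), endpointLM (-endpointWeight (N + 1))
      (secondS (N + 1) * (secondR (N + 1) /ₘ (X - C x))) = secondA (N + 1) := by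
    intro x hx
    rcases N with _ | N
    · rw [Finset.card_eq_zero.1 hcard] at hx
      simp at hx
    · refine endpointLM_secondS_mul_divByMonic N ?_
      rwa [nodes, Multiset.mem_toFinset, mem_roots (secondR_ne_zero _)] at hx
  have hSdeg : (secondS (N + 1)).natDegree ≤ (secondR (N + 1)).natDegree - 1 := by
    rcases N with _ | N
    · have : secondS 1 = 0 := by
        rw [secondS, show geg (((1 : ℕ) : ℤ) - 2) = 0 from rfl,
          show geg (((1 : ℕ) : ℤ) - 3) = 0 from rfl]
        simp
      simp [this]
    · rw [hdeg]
      exact natDegree_secondS_le N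
  have hA : secondA (N + 1) ≠ 0 := by
    have : secondA (N + 1) = 2 * ((N : ℝ) + 1) * (2 * N + 1) := by
      rw [secondA]
      push_cast
      ring
    rw [this]
    positivity
  obtain ⟨hne, hrule⟩ := weighted_rule (d := N + 1) (secondR_ne_zero N) (hcard.trans hdeg.symm) hA
    (fun q hq => endpointLM_secondR_mul N hq) (by omega) hSdeg hdiv
  exact ⟨hne, fun p hp => hrule p (by omega)⟩

/-! ### Splines on the uniform line -/

lemma integral_eq_integral_reference (f : ℝ → ℝ) (l h : ℝ) :
    ∫ x in l..l + h, f x = h / 2 * ∫ x in (-1 : ℝ)..1, f (l + h * (x + 1) / 2) := by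
  have h1 := intervalIntegral.smul_integral_comp_mul_add (a := -1) (b := 1) f (h / 2) (l + h / 2)
  rw [smul_eq_mul, show h / 2 * -1 + (l + h / 2) = l by ring,
    show h / 2 * 1 + (l + h / 2) = l + h by ring] at h1
  rw [← h1]
  congr 2
  ext x
  congr 1
  ring

/-- Pulled back to the reference interval `[-1, 1]`, each piece of a spline is a polynomial. -/
lemma IsC0Spline.exists_reference {D : ℕ} {a h : ℝ} {f : ℝ → ℝ} (hf : IsC0Spline D a h f)
    (hh : 0 < h) (j : ℤ) : ∃ q : ℝ[X], q.natDegree ≤ D ∧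
      ∀ x ∈ Set.Icc (-1 : ℝ) 1, f (a + j * h + h * (x + 1) / 2) = q.eval x := by
  obtain ⟨p, hp, hfp⟩ := hf.piecewise j
  refine ⟨p.comp (C (h / 2) * X + C (a + j * h + h / 2)), ?_, fun x hx => ?_⟩
  · refine natDegree_comp_le.trans ?_
    refine (Nat.mul_le_mul hp (natDegree_linear_le (a := h / 2))).trans (by simp)
  · rw [hfp]
    · simp only [eval_comp, eval_add, eval_mul, eval_C, eval_X]
      congr 1
      ring
    · constructor
      · have : 0 ≤ h * (x + 1) := mul_nonneg hh.le (by linarith [hx.1])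
        linarith
      · have : h * (x + 1) ≤ h * 2 := mul_le_mul_of_nonneg_left (by linarith [hx.2]) hh.le
        linarith

/-- An interval rule that reproduces `endpointLM c` on the reference interval integrates a
function that is polynomial there up to a multiple of the two endpoint values. -/
lemma intervalRule_eq {A c l h : ℝ} {R S q : ℝ[X]} {f : ℝ → ℝ}
    (hIoo : ∀ x ∈ nodes R, x ∈ Set.Ioo (-1 : ℝ) 1)
    (hq : ∀ x ∈ Set.Icc (-1 : ℝ) 1, f (l + h * (x + 1) / 2) = q.eval x)
    (hrule : endpointLM c q = ∑ x ∈ nodes R, weight A R S x * q.eval x) :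
    intervalRule A R S l h f = (∫ x in l..l + h, f x) + h / 2 * c * (f l + f (l + h)) := by
  have h1 : intervalRule A R S l h f = h / 2 * endpointLM c q := by
    rw [hrule, intervalRule, Finset.mul_sum]
    refine Finset.sum_congr rfl fun x hx => ?_
    rw [hq x (Set.Ioo_subset_Icc_self (hIoo x hx)), mul_assoc]
  have h2 : ∫ x in l..l + h, f x = h / 2 * integralLM q := by
    rw [integral_eq_integral_reference, integralLM_apply]
    congr 1
    refine intervalIntegral.integral_congr fun x hx => ?_
    rw [Set.uIcc_of_le (by norm_num)] at hx
    exact hq x hx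
  have h3 := hq 1 (by norm_num)
  have h4 := hq (-1) (by norm_num)
  rw [show l + h * (1 + 1) / 2 = l + h by ring] at h3
  rw [show l + h * (-1 + 1) / 2 = l by ring] at h4
  rw [h1, h2, h3, h4, endpointLM_apply]
  ring

/-- The endpoint terms of the two rules cancel at the midpoint of a period, and leave a
telescoping term. -/
lemma periodSum_eq {N : ℕ} {a h : ℝ} {f : ℝ → ℝ} (hf : IsC0Spline (2 * N + 1) a h f) (hh : 0 < h)
    (k : ℤ) : periodSum (N + 1) a h f k =
      (∫ x in a + k * (2 * h)..a + (k + 1) * (2 * h), f x)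
        + h / 2 * endpointWeight (N + 1) *
          (f (a + k * (2 * h)) - f (a + ((k + 1 : ℤ) : ℝ) * (2 * h))) := by
  obtain ⟨q₁, hq₁, hfq₁⟩ := hf.exists_reference hh (2 * k)
  obtain ⟨q₂, hq₂, hfq₂⟩ := hf.exists_reference hh (2 * k + 1)
  push_cast at hfq₁ hfq₂ ⊢
  obtain ⟨-, hI₁, hr₁⟩ := first_rule N
  have e₁ := intervalRule_eq (fun x hx => (hI₁ x hx).1) hfq₁ (hr₁ q₁ hq₁)
  have e₂ := intervalRule_eq (card_nodes_secondR N).2 hfq₂ ((second_rule N).2 q₂ hq₂)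
  have hi : ∀ u v : ℝ, IntervalIntegrable f volume u v := hf.continuous.intervalIntegrable
  have hsum := intervalIntegral.integral_add_adjacent_intervals
    (hi (a + 2 * k * h) (a + 2 * k * h + h)) (hi (a + 2 * k * h + h) (a + (k + 1) * (2 * h)))
  rw [show a + (2 * (k : ℝ) + 1) * h = a + 2 * k * h + h by ring,
    show a + 2 * (k : ℝ) * h + h + h = a + (k + 1) * (2 * h) by ring] at e₂
  rw [periodSum, show a + (2 * (k : ℝ) + 1) * h = a + 2 * k * h + h by ring, e₁, e₂,
    show a + (k : ℝ) * (2 * h) = a + 2 * k * h by ring, ← hsum]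
  ring

/-- On polynomials of bounded degree, evaluation at `-1` is bounded by the `L¹` norm on `[-1, 1]`:
the signed half difference of `D_{d+1}` and `D_d` is a reproducing kernel for it. -/
lemma exists_abs_eval_neg_one_le (d : ℕ) : ∃ B : ℝ, 0 ≤ B ∧ ∀ q : ℝ[X], q.natDegree ≤ d →
    |q.eval (-1)| ≤ B * ∫ x in (-1 : ℝ)..1, |q.eval x| := by
  set K := legendreDeriv (d + 1) - legendreDeriv d with hK
  obtain ⟨B, hB⟩ := isCompact_Icc.exists_bound_of_continuousOn
    (s := Set.Icc (-1 : ℝ) 1) (f := fun x => K.eval x) K.continuous.continuousOn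
  have hB0 : 0 ≤ B := (norm_nonneg _).trans (hB 1 (by norm_num))
  refine ⟨B / 2, by positivity, fun q hq => ?_⟩
  have h1 : integralLM (K * q) = 2 * (-1) ^ d * q.eval (-1) := by
    rw [hK, sub_mul, map_sub, integralLM_legendreDeriv_mul hq,
      integralLM_legendreDeriv_mul (hq.trans (Nat.le_succ d)), pow_succ]
    ring
  have h2 : |integralLM (K * q)| = 2 * |q.eval (-1)| := by
    rw [h1, abs_mul, abs_mul, abs_pow]
    simp
  have h3 : |integralLM (K * q)| ≤ ∫ x in (-1 : ℝ)..1, B * |q.eval x| := by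
    rw [integralLM_apply]
    refine (intervalIntegral.abs_integral_le_integral_abs (by norm_num)).trans ?_
    refine intervalIntegral.integral_mono_on (by norm_num)
      ((K * q).continuous.abs.intervalIntegrable _ _)
      ((q.continuous.abs.const_mul B).intervalIntegrable _ _) fun x hx => ?_
    rw [eval_mul, abs_mul]
    exact mul_le_mul_of_nonneg_right (hB x hx) (abs_nonneg _)
  rw [h2, intervalIntegral.integral_const_mul] at h3
  linarith

lemma hasSum_integral_periods {g : ℝ → ℝ} (hg : Integrable g) (a : ℝ) {T : ℝ} (hT : 0 < T) :
    HasSum (fun k : ℤ => ∫ x in a + k * T..a + (k + 1) * T, g x) (∫ x, g x) := by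
  have h1 : Integrable fun x => g (T * x + a) :=
    (hg.comp_add_right a).comp_mul_left' hT.ne'
  have h2 := (h1.hasSum_intervalIntegral 0).mul_left T
  have h3 : T * ∫ x, g (T * x + a) = ∫ x, g x := by
    rw [Measure.integral_comp_mul_left (fun x => g (x + a)) T, integral_add_right_eq_self g a,
      abs_of_pos (inv_pos.2 hT), smul_eq_mul, mul_inv_cancel_left₀ hT.ne']
  rw [h3] at h2
  have h4 : ∀ k : ℤ, ∫ x in a + k * T..a + (k + 1) * T, g x =
      T * ∫ x in (0 : ℝ) + k..0 + k + 1, g (T * x + a) := fun k => by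
    rw [← smul_eq_mul (a := T), intervalIntegral.smul_integral_comp_mul_add]
    congr 1 <;> ring
  simpa only [h4] using h2

/-- The values of an integrable spline at every other knot are summable. -/
lemma IsC0Spline.summable_knots {D : ℕ} {a h : ℝ} {f : ℝ → ℝ} (hf : IsC0Spline D a h f)
    (hh : 0 < h) (hint : Integrable f) : Summable fun k : ℤ => f (a + k * (2 * h)) := by
  obtain ⟨B, hB0, hB⟩ := exists_abs_eval_neg_one_le D
  have hs := (hasSum_integral_periods hint.abs a (T := 2 * h) (by positivity)).summable
  refine Summable.of_norm_bounded (hs.mul_left (B * (2 / h))) fun k => ?_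
  obtain ⟨q, hq, hfq⟩ := hf.exists_reference hh (2 * k)
  have h1 : f (a + k * (2 * h)) = q.eval (-1) := by
    rw [← hfq (-1) (by norm_num)]
    congr 1
    push_cast
    ring
  have h2 : ∫ x in (-1 : ℝ)..1, |q.eval x| =
      2 / h * ∫ x in a + k * (2 * h)..a + k * (2 * h) + h, |f x| := by
    rw [integral_eq_integral_reference (fun x => |f x|), ← mul_assoc,
      show 2 / h * (h / 2) = 1 by field_simp, one_mul]
    refine intervalIntegral.integral_congr fun x hx => ?_
    rw [Set.uIcc_of_le (by norm_num)] at hx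
    rw [← hfq x hx, show a + ((2 * k : ℤ) : ℝ) * h = a + k * (2 * h) by push_cast; ring]
  have h3 : ∫ x in a + k * (2 * h)..a + k * (2 * h) + h, |f x| ≤
      ∫ x in a + k * (2 * h)..a + (k + 1) * (2 * h), |f x| :=
    intervalIntegral.integral_mono_interval le_rfl (by linarith) (by linarith)
      (Filter.Eventually.of_forall fun x => abs_nonneg _)
      (hf.continuous.abs.intervalIntegrable _ _)
  rw [Real.norm_eq_abs, h1]
  refine (hB q hq).trans ?_
  rw [h2, ← mul_assoc]
  exact mul_le_mul_of_nonneg_left h3 (by positivity)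

lemma hasSum_periodSum {N : ℕ} {a h : ℝ} {f : ℝ → ℝ} (hf : IsC0Spline (2 * N + 1) a h f)
    (hh : 0 < h) (hint : Integrable f) :
    HasSum (fun k : ℤ => periodSum (N + 1) a h f k) (∫ x, f x) := by
  have h1 := hasSum_integral_periods hint a (T := 2 * h) (by positivity)
  have h2 := (hf.summable_knots hh hint).hasSum
  have h3 := h2.sub ((Equiv.addRight (1 : ℤ)).hasSum_iff.2 h2)
  rw [sub_self] at h3
  have h4 := h1.add (h3.mul_left (h / 2 * endpointWeight (N + 1)))
  rw [mul_zero, add_zero] at h4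
  simp only [periodSum_eq hf hh]
  exact h4

end SplineQuadrature

end

theorem mainTheorem1 (n : ℕ) (hn : 1 ≤ n) :
    -- first interval: `n` distinct nodes, all in `(-1, 1)`, with well-defined weights
    ((SplineQuadrature.firstR n).natDegree = n ∧
      (SplineQuadrature.nodes (SplineQuadrature.firstR n)).card = n ∧
      ∀ x ∈ SplineQuadrature.nodes (SplineQuadrature.firstR n), x ∈ Set.Ioo (-1 : ℝ) 1 ∧
        (SplineQuadrature.firstR n).derivative.eval x * (SplineQuadrature.firstS n).eval x ≠ 0) ∧
    -- second interval: `n - 1` distinct nodes, all in `(-1, 1)`, with well-defined weights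
    ((SplineQuadrature.secondR n).natDegree = n - 1 ∧
      (SplineQuadrature.nodes (SplineQuadrature.secondR n)).card = n - 1 ∧
      ∀ x ∈ SplineQuadrature.nodes (SplineQuadrature.secondR n), x ∈ Set.Ioo (-1 : ℝ) 1 ∧
        (SplineQuadrature.secondR n).derivative.eval x * (SplineQuadrature.secondS n).eval x ≠ 0) ∧
    -- exactness on every uniform grid, for every integrable spline
    ∀ (a h : ℝ), 0 < h → ∀ f : ℝ → ℝ, SplineQuadrature.IsC0Spline (2 * n - 1) a h f →
      Integrable f volume →
      HasSum (fun k : ℤ => SplineQuadrature.periodSum n a h f k) (∫ x, f x) := by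
  open SplineQuadrature in
  obtain ⟨N, rfl⟩ : ∃ N, n = N + 1 := ⟨n - 1, by omega⟩
  obtain ⟨hc₁, hx₁, -⟩ := first_rule N
  obtain ⟨hc₂, hx₂⟩ := card_nodes_secondR N
  refine ⟨⟨natDegree_firstR N, hc₁, hx₁⟩, ⟨natDegree_secondR N, hc₂,
    fun x hx => ⟨hx₂ x hx, (second_rule N).1 x hx⟩⟩, fun a h hh f hf hint => ?_⟩
  exact hasSum_periodSum (by rwa [show 2 * (N + 1) - 1 = 2 * N + 1 by omega] at hf) hh hint
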